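/- For every finite simple undirected graph $G$ on $n$ vertices, $\alpha_1(G)+\tau_B(G)\le \frac{4403\,n^2}{15000}$. Here $\alpha_1(G)$ is the maximum size of a set of edges of $G$ that contains at most one edge from each triangle of $G$, and $\tau_B(G)$ is the minimum size of a set of edges of $G$ whose deletion makes $G$ bipartite. -/

import Mathlib

namespace TriangleBipartite

/-- A set `A` of edges of `G` is triangle-independent if it contains at most one edge from each
triangle of `G`. -/
def IsTriangleIndependent {V : Type*} (G : SimpleGraph V) (A : Finset (Sym2 V)) : Prop :=
  (A : Set (Sym2 V)) ⊆ G.edgeSet ∧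
    ∀ a b c : V, G.Adj a b → G.Adj a c → G.Adj b c →
      ((A : Set (Sym2 V)) ∩ {s(a, b), s(a, c), s(b, c)}).Subsingleton

/-- A set `D` of edges of `G` whose deletion makes `G` bipartite. -/
def IsBipartizing {V : Type*} (G : SimpleGraph V) (D : Finset (Sym2 V)) : Prop :=
  (D : Set (Sym2 V)) ⊆ G.edgeSet ∧ (G.deleteEdges (D : Set (Sym2 V))).IsBipartite

/-- `α₁(G)`: the maximum size of a triangle-independent set of edges of `G` (for finite `V` the
maximum is attained, see `isGreatest_alphaOne`). -/
noncomputable def alphaOne {V : Type*} (G : SimpleGraph V) : ℕ :=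
  sSup {k : ℕ | ∃ A : Finset (Sym2 V), IsTriangleIndependent G A ∧ A.card = k}

/-- `τ_B(G)`: the minimum number of edges of `G` whose deletion makes `G` bipartite (for finite `V`
the minimum is attained, see `isLeast_tauB`). -/
noncomputable def tauB {V : Type*} (G : SimpleGraph V) : ℕ :=
  sInf {k : ℕ | ∃ D : Finset (Sym2 V), IsBipartizing G D ∧ D.card = k}

theorem isGreatest_alphaOne {V : Type*} [Fintype V] (G : SimpleGraph V) :
    IsGreatest {k : ℕ | ∃ A : Finset (Sym2 V), IsTriangleIndependent G A ∧ A.card = k}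
      (alphaOne G) := by
  have hb : BddAbove {k : ℕ | ∃ A : Finset (Sym2 V), IsTriangleIndependent G A ∧ A.card = k} :=
    ⟨Fintype.card (Sym2 V), by
      rintro k ⟨A, -, rfl⟩
      exact A.card_le_univ⟩
  refine ⟨Nat.sSup_mem ⟨0, ∅, ⟨by simp, by simp⟩, rfl⟩ hb, fun k hk => le_csSup hb hk⟩

theorem isLeast_tauB {V : Type*} [Fintype V] (G : SimpleGraph V) :
    IsLeast {k : ℕ | ∃ D : Finset (Sym2 V), IsBipartizing G D ∧ D.card = k} (tauB G) := by
  classical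
  refine ⟨Nat.sInf_mem ⟨_, G.edgeFinset, ⟨by simp, ?_⟩, rfl⟩, fun k hk => Nat.sInf_le hk⟩
  have h : G.deleteEdges (G.edgeFinset : Set (Sym2 V)) = ⊥ := by
    ext a b
    simp
  rw [h]
  exact ⟨SimpleGraph.Coloring.mk (fun _ => 0) (by simp)⟩

end TriangleBipartite

namespace TriangleBipartite

open Finset

/-! ### Cuts with undecided vertices -/

section Cut

variable {V : Type*} [Fintype V] (G : SimpleGraph V)

/-! A flag-algebra style argument gives the stronger constant 7/24. Fix a maximum
triangle-independent set and colour all ordered pairs of vertices. Each pair of roots `(u, v)`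
defines random cuts: the colours joining a vertex to the roots decide its side, or leave it to a
coin. Each cut bounds `τ_B` from above (`four_mul_tauB_le_uncut`). A weighted sum of these bounds
over all root pairs, plus squares, is a sum over quadruples of vertices; symmetrised over the choice
of roots, it is at most zero for every admissible colouring of the six pairs
(`sum_certificate_le_zero`, a finite check). So the weighted excess over the target is nonpositive.
-/

open Classical in
/-- Four times the expected number of edges that are not cut, when `x` is put on the side `s x` if
`s x = ±1` and on a uniformly random side if `s x = 0`. -/
noncomputable def uncut (s : V → ℤ) : ℤ :=
  ∑ x, ∑ y, if G.Adj x y then 1 + s x * s y else 0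

theorem four_mul_tauB_le_uncut_of_sign (s : V → ℤ) (hs : ∀ x, s x = 1 ∨ s x = -1) :
    4 * (tauB G : ℤ) ≤ uncut G s := by
  classical
  let H : SimpleGraph V :=
    { Adj := fun x y => G.Adj x y ∧ s x = s y
      symm := ⟨fun _ _ h => ⟨h.1.symm, h.2.symm⟩⟩
      loopless := ⟨fun _ h => G.loopless.irrefl _ h.1⟩ }
  have hle : H ≤ G := fun _ _ h => h.1
  have hbip : IsBipartizing G H.edgeFinset := by
    refine ⟨by simpa using hle, ⟨SimpleGraph.Coloring.mk (fun x => if s x = 1 then 0 else 1) ?_⟩⟩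
    intro x y hxy
    simp only [SimpleGraph.coe_edgeFinset, SimpleGraph.deleteEdges_adj, SimpleGraph.mem_edgeSet]
      at hxy
    have hne : s x ≠ s y := fun h => hxy.2 ⟨hxy.1, h⟩
    rcases hs x with hx | hx <;> rcases hs y with hy | hy <;> simp_all
  have hτ : tauB G ≤ #H.edgeFinset := (isLeast_tauB G).2 ⟨_, hbip, rfl⟩
  have hsum : uncut G s = 2 * ∑ x, (H.degree x : ℤ) := by
    rw [uncut, mul_sum]
    refine sum_congr rfl fun x _ => ?_
    rw [← SimpleGraph.card_neighborFinset_eq_degree, SimpleGraph.neighborFinset_eq_filter,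
      card_filter, Nat.cast_sum, mul_sum]
    refine sum_congr rfl fun y _ => ?_
    by_cases h : G.Adj x y
    · rcases hs x with hx | hx <;> rcases hs y with hy | hy <;> simp [H, h, hx, hy]
    · simp [H, h]
  have hdeg : ∑ x, (H.degree x : ℤ) = 2 * (#H.edgeFinset : ℤ) := by
    exact_mod_cast H.sum_degrees_eq_twice_card_edges
  rw [hsum, hdeg]
  have : (tauB G : ℤ) ≤ #H.edgeFinset := by exact_mod_cast hτ
  linarith

/-- Since `G` has no loops, `uncut` is affine in the value at `v`. -/
theorem uncut_update_add_uncut_update [DecidableEq V] (s : V → ℤ) (v : V) (hv : s v = 0) :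
    uncut G (Function.update s v 1) + uncut G (Function.update s v (-1)) = 2 * uncut G s := by
  simp only [uncut, mul_sum, ← sum_add_distrib]
  refine sum_congr rfl fun x _ => sum_congr rfl fun y _ => ?_
  by_cases h : G.Adj x y
  · have hne := h.ne
    by_cases hx : x = v
    · subst hx
      simp [h, hne.symm, hv]
      ring
    · by_cases hy : y = v
      · subst hy
        simp [h, hne, hv]
        ring
      · simp [h, hx, hy]
        ring
  · simp [h]

/-- Derandomisation: an undecided vertex is fixed both ways and the two bounds are averaged, by
induction on the number of undecided vertices. -/
theorem four_mul_tauB_le_uncut (s : V → ℤ) (hs : ∀ x, s x = 1 ∨ s x = -1 ∨ s x = 0) :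
    4 * (tauB G : ℤ) ≤ uncut G s := by
  classical
  induction h : #{x | s x = 0} using Nat.strong_induction_on generalizing s with
  | _ k ih =>
    by_cases hz : ∃ v, s v = 0
    · obtain ⟨v, hv⟩ := hz
      have key : ∀ ε : ℤ, ε = 1 ∨ ε = -1 → 4 * (tauB G : ℤ) ≤ uncut G (Function.update s v ε) := by
        intro ε hε
        refine ih _ ?_ _ (fun x => ?_) rfl
        · rw [← h]
          refine card_lt_card (ssubset_iff_of_subset (fun x hx => ?_) |>.2 ⟨v, by simp [hv], ?_⟩)
          · by_cases hxv : x = v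
            · simp [hxv, hv]
            · simpa [hxv] using hx
          · rcases hε with rfl | rfl <;> simp
        · by_cases hxv : x = v
          · subst hxv
            rcases hε with rfl | rfl <;> simp
          · simpa [hxv] using hs x
      have h1 := key 1 (Or.inl rfl)
      have h2 := key (-1) (Or.inr rfl)
      have := uncut_update_add_uncut_update G s v hv
      linarith
    · push Not at hz
      exact four_mul_tauB_le_uncut_of_sign G s fun x =>
        (hs x).imp_right fun h => h.resolve_right (hz x)

end Cut

/-! ### Edge colourings without a triangle that has two edges of colour `2`

Colour `0` stands for a non-edge, colour `2` for an edge of the triangle-independent set, and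
colour `1` for the other edges. -/

/-- Twelve times the contribution of an ordered pair of the given colour to the quantity
`2 * (α₁ + τ_B)` for a uniformly random cut. -/
def colorValue : Fin 3 → ℤ := ![0, 6, 18]

/-- The correction to `colorValue` per unit of correlation of the two ends in the cut. -/
def edgeValue : Fin 3 → ℤ := ![0, 6, 6]

/-- The side of a vertex joined to the two roots by the given colours, in the symmetric cut. -/
def symmSide : Fin 3 → Fin 3 → ℤ := ![![1, 1, -1], ![1, 0, -1], ![-1, -1, -1]]

/-- The side of a vertex joined to the two roots by the given colours, in the antisymmetric cut. -/
def antiSide : Fin 3 → Fin 3 → ℤ := ![![0, 1, 1], ![-1, 0, 1], ![-1, -1, 0]]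

/-- Vertex weights `f` for the squares `(∑ x, f x) ^ 2`, which may be added for free. Under exchange
of the roots, `squareA` and `squareC` change sign, while `squareB` and `squareD` are invariant. -/
def squareA : Fin 3 → Fin 3 → ℤ := ![![0, 0, 1], ![0, 0, 0], ![-1, 0, 0]]

def squareB : Fin 3 → Fin 3 → ℤ := ![![-7, -3, 1], ![-3, 1, 3], ![1, 3, 6]]

def squareC : Fin 3 → Fin 3 → ℤ := ![![0, 1, 0], ![-1, 0, 2], ![0, -2, 0]]

def squareD : Fin 3 → Fin 3 → ℤ := ![![1, -3, 0], ![-3, -1, 4], ![0, 4, 0]]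

/-- The contribution of two vertices, joined to the roots by the colours `p, q` and `p', q'` and to
each other by the colour `z`, to the cut given by `side`, in excess of the target. -/
def cutTerm (side : Fin 3 → Fin 3 → ℤ) (p q p' q' z : Fin 3) : ℤ :=
  colorValue z - 7 + edgeValue z * (side p q * side p' q')

/-- The integrand of the certificate; the roots are joined by the colour `r`. -/
def certificate (r p q p' q' z : Fin 3) : ℤ :=
  if r = 0 then
    50 * cutTerm symmSide p q p' q' z + 420 * (squareA p q * squareA p' q')
      + 6 * (squareB p q * squareB p' q')
  else if r = 1 then
    22 * cutTerm symmSide p q p' q' z + 27 * cutTerm antiSide p q p' q' z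
      + 108 * (squareC p q * squareC p' q') + 480 * (squareA p q * squareA p' q')
      + 30 * (squareD p q * squareD p' q')
  else 0

/-- No triangle with these colours has two edges of colour `2`. -/
def TriangleOK (a b c : Fin 3) : Prop :=
  a = 0 ∨ b = 0 ∨ c = 0 ∨ (a ≠ 2 ∧ b ≠ 2) ∨ (a ≠ 2 ∧ c ≠ 2) ∨ (b ≠ 2 ∧ c ≠ 2)

instance (a b c : Fin 3) : Decidable (TriangleOK a b c) := by
  unfold TriangleOK
  infer_instance

theorem sum_certificate_le_zero : ∀ a b c d e f : Fin 3,
    TriangleOK a b d → TriangleOK a c e → TriangleOK b c f → TriangleOK d e f →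
      certificate a b d c e f + certificate b a d c f e + certificate c a e b f d
        + certificate d a b e f c + certificate e a c d f b + certificate f b c d e a ≤ 0 := by
  decide +kernel

section Certificate

variable {V : Type*} [Fintype V]

theorem sum_mul_self_nonneg (g : V → ℤ) : 0 ≤ ∑ x, ∑ y, g x * g y := by
  rw [← sum_mul_sum]
  exact mul_self_nonneg _

theorem sum_certificate_nonpos (c : V → V → Fin 3) (hsymm : ∀ x y, c x y = c y x)
    (htri : ∀ x y z, TriangleOK (c x y) (c x z) (c y z)) :
    ∑ u, ∑ v, ∑ x, ∑ y, certificate (c u v) (c u x) (c v x) (c u y) (c v y) (c x y) ≤ 0 := by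
  let F : V → V → V → V → ℤ := fun u v x y =>
    certificate (c u v) (c u x) (c v x) (c u y) (c v y) (c x y)
  have swap12 : ∀ H : V → V → V → V → ℤ,
      ∑ u, ∑ v, ∑ x, ∑ y, H u v x y = ∑ u, ∑ v, ∑ x, ∑ y, H v u x y := fun H => sum_comm
  have swap23 : ∀ H : V → V → V → V → ℤ,
      ∑ u, ∑ v, ∑ x, ∑ y, H u v x y = ∑ u, ∑ v, ∑ x, ∑ y, H u x v y :=
    fun H => sum_congr rfl fun u _ => sum_comm
  have swap34 : ∀ H : V → V → V → V → ℤ,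
      ∑ u, ∑ v, ∑ x, ∑ y, H u v x y = ∑ u, ∑ v, ∑ x, ∑ y, H u v y x :=
    fun H => sum_congr rfl fun u _ => sum_congr rfl fun v _ => sum_comm
  have e1 := swap23 F
  have e2 := e1.trans (swap34 _)
  have e3 := e1.trans (swap12 _)
  have e4 := e3.trans (swap34 _)
  have e5 := e4.trans (swap23 _)
  -- The six terms choose each pair of the quadruple as roots; all have the same total. Quadruples
  -- with repeated vertices are included.
  have hsum : ∑ u, ∑ v, ∑ x, ∑ y, (F u v x y + F u x v y + F u y v x + F v x u y + F v y u x
      + F x y u v) ≤ 0 := by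
    refine sum_nonpos fun u _ => sum_nonpos fun v _ => sum_nonpos fun x _ => sum_nonpos fun y _ => ?_
    have h := sum_certificate_le_zero (c u v) (c u x) (c u y) (c v x) (c v y) (c x y)
      (htri u v x) (htri u v y) (htri u x y) (htri v x y)
    simpa only [F, hsymm x u, hsymm y u, hsymm v u, hsymm x v, hsymm y v, hsymm y x] using h
  simp only [sum_add_distrib] at hsum
  change ∑ u, ∑ v, ∑ x, ∑ y, F u v x y ≤ 0
  linarith

theorem le_of_forall_cut [Nonempty V] (c : V → V → Fin 3) (hsymm : ∀ x y, c x y = c y x)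
    (hdiag : ∀ x, c x x = 0) (htri : ∀ x y z, TriangleOK (c x y) (c x z) (c y z)) (K : ℤ)
    (hK : ∀ s : V → ℤ, (∀ x, s x = 1 ∨ s x = -1 ∨ s x = 0) →
      K ≤ ∑ x, ∑ y, (colorValue (c x y) + edgeValue (c x y) * (s x * s y))) :
    K ≤ 7 * (Fintype.card V : ℤ) ^ 2 := by
  set n : ℤ := (Fintype.card V : ℤ) with hn
  have hcut : ∀ side : Fin 3 → Fin 3 → ℤ,
      (∀ p q, side p q = 1 ∨ side p q = -1 ∨ side p q = 0) → ∀ u v,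
      K - 7 * n ^ 2 ≤ ∑ x, ∑ y, cutTerm side (c u x) (c v x) (c u y) (c v y) (c x y) := by
    intro side hside u v
    have h := hK (fun x => side (c u x) (c v x)) fun x => hside _ _
    have h7 : ∑ _x : V, ∑ _y : V, (7 : ℤ) = 7 * n ^ 2 := by
      simp [hn]
      ring
    rw [← h7]
    refine (sub_le_sub_right h _).trans (le_of_eq ?_)
    simp only [← sum_sub_distrib, cutTerm]
    exact sum_congr rfl fun x _ => sum_congr rfl fun y _ => by ring
  have hs : ∀ p q, symmSide p q = 1 ∨ symmSide p q = -1 ∨ symmSide p q = 0 := by decide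
  have ha : ∀ p q, antiSide p q = 1 ∨ antiSide p q = -1 ∨ antiSide p q = 0 := by decide
  -- Total weight of the cuts in `certificate` for each root colour; `49 = 22 + 27`.
  let w : Fin 3 → ℤ := ![50, 49, 0]
  have hw0 : ∀ r, 0 ≤ w r := by decide
  have hroot : ∀ u v, w (c u v) * (K - 7 * n ^ 2) ≤
      ∑ x, ∑ y, certificate (c u v) (c u x) (c v x) (c u y) (c v y) (c x y) := by
    intro u v
    have h1 := hcut _ hs u v
    have h2 := hcut _ ha u v
    have hA := sum_mul_self_nonneg fun x => squareA (c u x) (c v x)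
    have hB := sum_mul_self_nonneg fun x => squareB (c u x) (c v x)
    have hC := sum_mul_self_nonneg fun x => squareC (c u x) (c v x)
    have hD := sum_mul_self_nonneg fun x => squareD (c u x) (c v x)
    simp only [← mul_sum] at hA hB hC hD
    generalize c u v = r
    fin_cases r
    · simp only [certificate, w, sum_add_distrib, ← mul_sum, Fin.zero_eta, if_true,
        Matrix.cons_val_zero]
      linarith
    · simp only [certificate, w, sum_add_distrib, ← mul_sum, Fin.mk_one, one_ne_zero, if_false,
        if_true, Matrix.cons_val_one, Matrix.cons_val_zero]
      linarith
    · simp [certificate, w]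
  have hle : (∑ u, ∑ v, w (c u v)) * (K - 7 * n ^ 2) ≤ 0 := by
    refine le_trans ?_ (sum_certificate_nonpos c hsymm htri)
    simp only [sum_mul]
    exact sum_le_sum fun u _ => sum_le_sum fun v _ => hroot u v
  -- Coinciding roots have colour `0`, hence weight `50`.
  have hpos : 0 < ∑ u, ∑ v, w (c u v) := by
    have hnn : ∀ u, 0 ≤ ∑ v, w (c u v) := fun u => sum_nonneg fun v _ => hw0 _
    obtain ⟨u⟩ := ‹Nonempty V›
    refine lt_of_lt_of_le ?_ (single_le_sum (fun u _ => hnn u) (mem_univ u))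
    refine lt_of_lt_of_le ?_ (single_le_sum (fun v _ => hw0 (c u v)) (mem_univ u))
    simp [hdiag, w]
  by_contra! h
  exact absurd hle (not_le.2 (mul_pos hpos (by linarith)))

end Certificate

/-! ### The colouring of a triangle-independent set -/

section Main

variable {V : Type*} {G : SimpleGraph V} {A : Finset (Sym2 V)}

open Classical in
/-- The colouring of the pairs of vertices given by a set `A` of edges of `G`. -/
noncomputable def pairColor (G : SimpleGraph V) (A : Finset (Sym2 V)) (x y : V) : Fin 3 :=
  if s(x, y) ∈ A then 2 else if G.Adj x y then 1 else 0

theorem adj_of_pairColor_ne_zero (hA : IsTriangleIndependent G A) {x y : V}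
    (h : pairColor G A x y ≠ 0) : G.Adj x y := by
  by_contra hn
  have : s(x, y) ∉ A := fun h' => hn (hA.1 h')
  simp [pairColor, this, hn] at h

theorem pairColor_eq_two_iff {x y : V} : pairColor G A x y = 2 ↔ s(x, y) ∈ A := by
  unfold pairColor
  split_ifs <;> simp_all

theorem triangleOK_pairColor (hA : IsTriangleIndependent G A) (x y z : V) :
    TriangleOK (pairColor G A x y) (pairColor G A x z) (pairColor G A y z) := by
  by_cases hxy : pairColor G A x y = 0
  · exact Or.inl hxy
  by_cases hxz : pairColor G A x z = 0
  · exact Or.inr (Or.inl hxz)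
  by_cases hyz : pairColor G A y z = 0
  · exact Or.inr (Or.inr (Or.inl hyz))
  have hab := adj_of_pairColor_ne_zero hA hxy
  have hac := adj_of_pairColor_ne_zero hA hxz
  have hbc := adj_of_pairColor_ne_zero hA hyz
  have hsub := hA.2 x y z hab hac hbc
  have hne1 : s(x, y) ≠ s(x, z) := by simp [hbc.ne, hac.ne]
  have hne2 : s(x, y) ≠ s(y, z) := by simp [hab.ne, hac.ne]
  have hne3 : s(x, z) ≠ s(y, z) := by simp [hab.ne, hac.ne]
  have h1 : ¬(s(x, y) ∈ A ∧ s(x, z) ∈ A) := fun h =>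
    hne1 (hsub ⟨h.1, by simp⟩ ⟨h.2, by simp⟩)
  have h2 : ¬(s(x, y) ∈ A ∧ s(y, z) ∈ A) := fun h =>
    hne2 (hsub ⟨h.1, by simp⟩ ⟨h.2, by simp⟩)
  have h3 : ¬(s(x, z) ∈ A ∧ s(y, z) ∈ A) := fun h =>
    hne3 (hsub ⟨h.1, by simp⟩ ⟨h.2, by simp⟩)
  simp only [TriangleOK, ne_eq, pairColor_eq_two_iff]
  tauto

theorem sum_mem_eq_two_mul_card [Fintype V] [DecidableEq V] (hA : (A : Set (Sym2 V)) ⊆ G.edgeSet) :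
    ∑ x, ∑ y, (if s(x, y) ∈ A then (1 : ℤ) else 0) = 2 * #A := by
  classical
  obtain ⟨H, hH⟩ : ∃ H, H = SimpleGraph.fromEdgeSet (A : Set (Sym2 V)) := ⟨_, rfl⟩
  have hadj : ∀ x y, H.Adj x y ↔ s(x, y) ∈ A := fun x y => by
    simp only [hH, SimpleGraph.fromEdgeSet_adj, mem_coe, and_iff_left_iff_imp]
    exact fun h => (SimpleGraph.mem_edgeSet G |>.1 (hA h)).ne
  have hedge : H.edgeFinset = A := by
    ext e
    induction e with
    | _ x y => simp [hadj]
  have h : ∑ x, (H.degree x : ℤ) = 2 * #A := by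
    exact_mod_cast H.sum_degrees_eq_twice_card_edges.trans (congrArg (2 * #·) hedge)
  rw [← h]
  refine sum_congr rfl fun x _ => ?_
  rw [← SimpleGraph.card_neighborFinset_eq_degree, SimpleGraph.neighborFinset_eq_filter,
    card_filter, Nat.cast_sum]
  exact sum_congr rfl fun y _ => by simp [hadj]

/-- A bound that is stronger than the one of the main theorem. -/
theorem twentyFour_mul_alphaOne_add_tauB_le [Fintype V] (G : SimpleGraph V) :
    24 * ((alphaOne G : ℤ) + tauB G) ≤ 7 * (Fintype.card V : ℤ) ^ 2 := by
  classical
  obtain ⟨A, hA, hcard⟩ := (isGreatest_alphaOne G).1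
  rcases isEmpty_or_nonempty V with hV | hV
  · have h1 : alphaOne G = 0 := by rw [← hcard, A.eq_empty_of_isEmpty, card_empty]
    have h2 := four_mul_tauB_le_uncut G (fun _ => 0) (by simp)
    simp only [uncut, univ_eq_empty, sum_empty] at h2
    simp only [h1, Fintype.card_eq_zero]
    push_cast
    linarith
  refine le_of_forall_cut (pairColor G A) (fun x y => ?_) (fun x => ?_)
    (triangleOK_pairColor hA) _ fun s hs => ?_
  · simp only [pairColor, Sym2.eq_swap (a := x), G.adj_comm x]
  · by_contra h
    exact (adj_of_pairColor_ne_zero hA h).ne rfl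
  · have hτ := four_mul_tauB_le_uncut G s hs
    have hα := sum_mem_eq_two_mul_card hA.1
    have : ∑ x, ∑ y, (colorValue (pairColor G A x y) + edgeValue (pairColor G A x y) * (s x * s y))
        = 12 * (∑ x, ∑ y, if s(x, y) ∈ A then (1 : ℤ) else 0) + 6 * uncut G s := by
      simp only [uncut, mul_sum, ← sum_add_distrib]
      refine sum_congr rfl fun x _ => sum_congr rfl fun y _ => ?_
      by_cases hm : s(x, y) ∈ A
      · have hadj : G.Adj x y := hA.1 hm
        simp [pairColor, hm, hadj, colorValue, edgeValue]
        ring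
      · by_cases hadj : G.Adj x y
        · simp [pairColor, hm, hadj, colorValue, edgeValue]
          ring
        · simp [pairColor, hm, hadj, colorValue, edgeValue]
    rw [this, hα, hcard]
    linarith

end Main

end TriangleBipartite

theorem theoremt {V : Type*} [Fintype V] (G : SimpleGraph V) :
    (TriangleBipartite.alphaOne G : ℝ) + (TriangleBipartite.tauB G : ℝ) ≤
      4403 * (Fintype.card V : ℝ) ^ 2 / 15000 := by
  have h : (24 : ℝ) * ((TriangleBipartite.alphaOne G : ℝ) + TriangleBipartite.tauB G) ≤
      7 * (Fintype.card V : ℝ) ^ 2 := by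
    exact_mod_cast TriangleBipartite.twentyFour_mul_alphaOne_add_tauB_le G
  have := sq_nonneg (Fintype.card V : ℝ)
  -- `7 / 24 = 4375 / 15000`.
  linarith
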